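/- Let $2<p<6$, $2<r<4$, $\alpha,\sigma\in\mathbb R$ and $\beta\ge 0$. Let $K_0$ be the Macdonald function (modified Bessel function of the second kind) of order zero, and let $\mathcal D$ be the set of pairs $U=(u,v)\in L^2(\mathbb R;\mathbb C)\times L^2(\mathbb R^2;\mathbb C)$ such that $u\in H^1(\mathbb R)$ and $$v(x)=\phi(x)+q\,\frac{K_0(|x|)}{2\pi}\quad\text{for a.e. }x\in\mathbb R^2,\qquad \phi\in H^1(\mathbb R^2),\ q\in\mathbb C$$ ($\phi$ and $q$ are determined by $v$). For $U\in\mathcal D$ put $$E(U)=\tfrac12\|u'\|_{L^2(\mathbb R)}^2+\tfrac\alpha2|u(0)|^2-\tfrac1p\|u\|_{L^p(\mathbb R)}^p+\tfrac12\|\phi\|_{H^1(\mathbb R^2)}^2-\tfrac12\|v\|_{L^2(\mathbb R^2)}^2+\tfrac\sigma2|q|^2-\tfrac1r\|v\|_{L^r(\mathbb R^2)}^r-\beta\,\mathrm{Re}\big(\overline q\,u(0)\big),$$ where $u(0)$ is the value at $0$ of the continuous representative of $u$ and $\|\phi\|_{H^1}^2=\|\nabla\phi\|_{L^2}^2+\|\phi\|_{L^2}^2$.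 Then $E$ is well defined on $\mathcal D$, that is, $u\in L^p(\mathbb R)$ and $v\in L^r(\mathbb R^2)$ for every $U\in\mathcal D$; and for every $\mu>0$ the functional $E$ is bounded below on the set of all $U\in\mathcal D$ with $$\int_{\mathbb R}|u|^2\,dx+\int_{\mathbb R^2}|v|^2\,dx=\mu .$$ -/

import Mathlib

open MeasureTheory
open scoped FourierTransform SchwartzMap LineDeriv ContDiff ENNReal

noncomputable section

namespace Hybrid

section Sobolev

variable {E : Type*} [NormedAddCommGroup E] [InnerProductSpace ℝ E] [FiniteDimensional ℝ E]
  [MeasurableSpace E] [BorelSpace E]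

/-- The Sobolev space `H¹(E)`, as a set of classes in `L²(E; ℂ)`. -/
def MemH1 (f : Lp ℂ 2 (volume : Measure E)) : Prop :=
  TemperedDistribution.MemSobolev 1 2 (f : 𝓢'(E, ℂ))

/-- The distributional derivative of an `H¹` function along a vector is an `L²` function. -/
theorem exists_weakDeriv (f : Lp ℂ 2 (volume : Measure E)) (hf : MemH1 f) (m : E) :
    ∃ g : Lp ℂ 2 (volume : Measure E), ∂_{m} (f : 𝓢'(E, ℂ)) = (g : 𝓢'(E, ℂ)) := by
  have h := TemperedDistribution.MemSobolev.lineDerivOp (m := m) hf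
  rw [sub_self] at h
  exact TemperedDistribution.memSobolev_zero_iff.mp h

/-- The weak derivative `∂_m f ∈ L²` of `f ∈ H¹` along `m`: the `L²` class that represents the
distributional derivative of `f`. -/
def weakDeriv (f : Lp ℂ 2 (volume : Measure E)) (hf : MemH1 f) (m : E) :
    Lp ℂ 2 (volume : Measure E) :=
  (exists_weakDeriv f hf m).choose

theorem weakDeriv_spec (f : Lp ℂ 2 (volume : Measure E)) (hf : MemH1 f) (m : E) :
    ∂_{m} (f : 𝓢'(E, ℂ)) = (weakDeriv f hf m : 𝓢'(E, ℂ)) :=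
  (exists_weakDeriv f hf m).choose_spec

end Sobolev

/-- A function of `H¹(ℝ)` has a continuous representative. -/
theorem exists_continuous_rep (f : Lp ℂ 2 (volume : Measure ℝ)) (hf : MemH1 f) :
    ∃ c : ℝ → ℂ, Continuous c ∧ ∀ᵐ x : ℝ, f x = c x := by
  obtain ⟨w, hw⟩ := TemperedDistribution.MemSobolev.fourier_memL1 (by simp) hf
  have hwi : Integrable (fun k : ℝ => w k) := L1.integrable_coeFn w
  refine ⟨Real.Lp.fourierTransformInv w, (Real.Lp.fourierTransformInv w).continuous, ?_⟩
  apply ae_eq_of_integral_contDiff_smul_eq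
  · exact (Lp.memLp f).locallyIntegrable (by norm_num)
  · exact (Real.Lp.fourierTransformInv w).continuous.locallyIntegrable
  · intro g g_smooth g_cpt
    have hg₁ : HasCompactSupport (Complex.ofRealCLM ∘ g) := g_cpt.comp_left rfl
    have hg₂ : ContDiff ℝ ∞ (Complex.ofRealCLM ∘ g) := by fun_prop
    set h : 𝓢(ℝ, ℂ) := hg₁.toSchwartzMap hg₂ with hh
    have hval : ∀ x, h x = (g x : ℂ) := fun x => rfl
    have h1 : (f : 𝓢'(ℝ, ℂ)) h = (w : 𝓢'(ℝ, ℂ)) (𝓕⁻ h) := by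
      rw [← hw, TemperedDistribution.fourier_apply, FourierTransform.fourier_fourierInv_eq]
    rw [Lp.toTemperedDistribution_apply, Lp.toTemperedDistribution_apply] at h1
    have h2 : ∫ k, (𝓕⁻ h) k • w k = ∫ k, 𝓕 (h : ℝ → ℂ) k • w (-k) := by
      rw [← integral_neg_eq_self]
      congr 1
      ext k
      rw [SchwartzMap.fourierInv_coe, Real.fourierInv_eq_fourier_neg, neg_neg]
    have h3 : ∫ k, 𝓕 (h : ℝ → ℂ) k • w (-k)
        = ∫ x, h x • 𝓕 (fun k : ℝ => w (-k)) x := by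
      have h5 := VectorFourier.integral_fourierIntegral_smul_eq_flip (L := innerₗ ℝ)
        (μ := (volume : Measure ℝ)) (ν := (volume : Measure ℝ))
        Real.continuous_fourierChar continuous_inner h.integrable hwi.comp_neg
      rw [flip_innerₗ] at h5
      exact h5
    have h4 : ∀ x, 𝓕 (fun k : ℝ => w (-k)) x = Real.Lp.fourierTransformInv w x := by
      intro x
      rw [Real.Lp.fourierTransformInv_apply, Real.fourierInv_eq_fourier_comp_neg]
    simp only [h4] at h3
    simpa [hval] using h1.trans (h2.trans h3)

/-- The value `f(x)` of `f ∈ H¹(ℝ)`: the value at `x` of the continuous representative of `f`. -/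
def pointValue (f : Lp ℂ 2 (volume : Measure ℝ)) (hf : MemH1 f) (x : ℝ) : ℂ :=
  (exists_continuous_rep f hf).choose x

/-- The point value does not depend on how the continuous representative is chosen. -/
theorem pointValue_eq (f : Lp ℂ 2 (volume : Measure ℝ)) (hf : MemH1 f) (c : ℝ → ℂ)
    (hc : Continuous c) (hfc : ∀ᵐ x : ℝ, f x = c x) (x : ℝ) : pointValue f hf x = c x := by
  obtain ⟨h1, h2⟩ := (exists_continuous_rep f hf).choose_spec
  have h3 : (exists_continuous_rep f hf).choose =ᵐ[volume] c := by
    filter_upwards [h2, hfc] with y hy hy'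
    rw [← hy, hy']
  exact congrFun ((Continuous.ae_eq_iff_eq volume h1 hc).mp h3) x

/-- The plane `Π`. -/
abbrev Plane : Type := EuclideanSpace ℝ (Fin 2)

/-- The Macdonald function of order zero,
`K₀(s) = ½ ∫₀^∞ exp(-t - s² / (4 t)) dt / t` for `s > 0`. -/
def macdonaldK0 (s : ℝ) : ℝ :=
  (1 / 2) * ∫ t in Set.Ioi (0 : ℝ), Real.exp (-t - s ^ 2 / (4 * t)) / t

/-- `‖∇φ‖²` in `L²(Π)`, for `φ ∈ H¹(Π)`. -/
def gradNormSq (φ : Lp ℂ 2 (volume : Measure Plane)) (hφ : MemH1 φ) : ℝ :=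
  ∑ i : Fin 2, ‖weakDeriv φ hφ (EuclideanSpace.single i 1)‖ ^ 2

/-- An element `U = (u, v)` of the energy domain `𝒟 ⊂ L²(ℓ) ⊕ L²(Π)` of the hybrid, together with
the decomposition `v = φ + q K₀(|·|) / (2π)`. (As `K₀(|·|)` is not in `H¹(Π)`, the regular part `φ`
and the charge `q` are determined by `v`.) -/
structure EnergyDomain where
  u : Lp ℂ 2 (volume : Measure ℝ)
  u_mem : MemH1 u
  v : Lp ℂ 2 (volume : Measure Plane)
  φ : Lp ℂ 2 (volume : Measure Plane)
  φ_mem : MemH1 φ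
  q : ℂ
  decomp : ∀ᵐ x : Plane, v x = φ x + q * ((macdonaldK0 ‖x‖ / (2 * Real.pi) : ℝ) : ℂ)

/-- The mass `∫_ℓ |u|² + ∫_Π |v|²`. -/
def EnergyDomain.mass (U : EnergyDomain) : ℝ :=
  (∫ x, ‖U.u x‖ ^ 2) + ∫ x, ‖U.v x‖ ^ 2

/-- The energy of the component on the line,
`½ ‖u'‖² - (1/p) ‖u‖_p^p + (α/2) |u(0)|²`. -/
def lineEnergy (p α : ℝ) (U : EnergyDomain) : ℝ :=
  1 / 2 * ‖weakDeriv U.u U.u_mem 1‖ ^ 2 - 1 / p * (∫ x, ‖U.u x‖ ^ p)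
    + α / 2 * ‖pointValue U.u U.u_mem 0‖ ^ 2

/-- The energy of the component on the plane,
`½ ‖φ‖²_{H¹} - ½ ‖v‖² + (σ/2) |q|² - (1/r) ‖v‖_r^r`, with `‖φ‖²_{H¹} = ‖∇φ‖² + ‖φ‖²`. -/
def planeEnergy (r σ : ℝ) (U : EnergyDomain) : ℝ :=
  1 / 2 * (gradNormSq U.φ U.φ_mem + ‖U.φ‖ ^ 2) - 1 / 2 * ‖U.v‖ ^ 2
    + σ / 2 * ‖U.q‖ ^ 2 - 1 / r * (∫ x, ‖U.v x‖ ^ r)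

/-- The coupling at the junction, `-β Re(q̄ u(0))`. -/
def junctionEnergy (β : ℝ) (U : EnergyDomain) : ℝ :=
  -β * (starRingEnd ℂ U.q * pointValue U.u U.u_mem 0).re

/-- The energy functional on the hybrid. -/
def energy (p r α σ β : ℝ) (U : EnergyDomain) : ℝ :=
  lineEnergy p α U + planeEnergy r σ U + junctionEnergy β U

end Hybrid

end

noncomputable section

namespace Hybrid

/-! ### Fourier side of weak derivatives and L² inversion. -/

section Fourier

variable {E : Type*} [NormedAddCommGroup E] [InnerProductSpace ℝ E] [FiniteDimensional ℝ E]
  [MeasurableSpace E] [BorelSpace E]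

/-! Everything is bounded by quadratic integrals on the Fourier side, weighted by powers of J(k) = 1
+ 4π²|k|².

In dimension d, a Gagliardo–Nirenberg bound (`memLp_and_integral_rpow_le`) controls ∫|f|^p by C
‖f‖^(p-2) ∫ J^θ |f̂|² with θ = d(p-2)/4. The assumptions p < 6 on the line and r < 4 on the plane
say exactly that θ < 1. At fixed mass the prefactor is bounded, so each nonlinear term becomes a
quadratic form of order below that of the kinetic energy.

On the line, C J^θ ≤ εJ + M pointwise; |u(0)|² is handled the same way with exponent 3/4, so the
kinetic term absorbs both (`exists_line_lower_bound`).

On the plane, v̂ = φ̂ + q/J, and J^θ |v̂|² is still integrable for θ < 1. The difficulty is |q|²,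
which has to be controlled with an arbitrarily large coefficient because of σ and the coupling.
After adding a multiple M of the mass, completing the square at each frequency leaves at least |q|²
(1/J - 1/a), where a = J - 1 - CJ^θ + M. Since ∫ 1/J diverges on the plane, the integral of this
weight can be made as large as desired by raising M, at a cost that depends only on the mass
(`exists_le_integral_inv_symbol_sub`, `exists_plane_lower_bound`).

The junction term is then split by Young's inequality between |q|² and |u(0)|². -/

theorem ae_eq_of_integral_schwartz_eq {f g : E → ℂ} (hf : LocallyIntegrable f volume)
    (hg : LocallyIntegrable g volume)
    (h : ∀ η : 𝓢(E, ℂ), ∫ x, η x • f x = ∫ x, η x • g x) : f =ᵐ[volume] g := by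
  apply ae_eq_of_integral_contDiff_smul_eq hf hg
  intro η η_smooth η_cpt
  have h₁ : HasCompactSupport (Complex.ofRealCLM ∘ η) := η_cpt.comp_left rfl
  have h₂ : ContDiff ℝ ∞ (Complex.ofRealCLM ∘ η) := by fun_prop
  have hval : ∀ x, h₁.toSchwartzMap h₂ x = (η x : ℂ) := fun x => rfl
  simpa [hval] using h (h₁.toSchwartzMap h₂)

theorem fourier_weakDeriv (f : Lp ℂ 2 (volume : Measure E)) (hf : MemH1 f) (m : E) :
    ∀ᵐ k, (𝓕 (weakDeriv f hf m) : Lp ℂ 2 (volume : Measure E)) k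
      = 2 * Real.pi * Complex.I * (inner ℝ k m : ℝ) * (𝓕 f : Lp ℂ 2 (volume : Measure E)) k := by
  have hloc := (Lp.memLp (𝓕 f : Lp ℂ 2 (volume : Measure E))).locallyIntegrable (by norm_num)
  apply ae_eq_of_integral_schwartz_eq
  · exact (Lp.memLp _).locallyIntegrable (by norm_num)
  · rw [locallyIntegrable_iff] at hloc ⊢
    intro K hK
    exact (hloc K hK).continuousOn_mul (by fun_prop) hK
  · intro η
    have ht : (fun k : E => (inner ℝ k m : ℝ)).HasTemperateGrowth := by fun_prop
    have h := congrArg (fun T : 𝓢'(E, ℂ) => (𝓕 T : 𝓢'(E, ℂ)) η) (weakDeriv_spec f hf m)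
    rw [TemperedDistribution.fourier_lineDerivOp_eq, Lp.fourier_toTemperedDistribution_eq,
      Lp.fourier_toTemperedDistribution_eq, Lp.toTemperedDistribution_apply] at h
    rw [← h]
    have ht' : (fun k : E => ((inner ℝ k m : ℝ) : ℂ)).HasTemperateGrowth := by fun_prop
    change (2 * Real.pi * Complex.I) • (TemperedDistribution.smulLeftCLM ℂ _ _) η = _
    rw [TemperedDistribution.smulLeftCLM_apply_apply, Lp.toTemperedDistribution_apply,
      ← integral_smul]
    congr 1
    ext k
    rw [SchwartzMap.smulLeftCLM_apply_apply ht']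
    simp only [smul_eq_mul]
    ring

theorem norm_sq_eq_integral (f : Lp ℂ 2 (volume : Measure E)) : ‖f‖ ^ 2 = ∫ x, ‖f x‖ ^ 2 := by
  have h := (Lp.memLp f).eLpNorm_eq_integral_rpow_norm (by norm_num) (by norm_num)
  rw [Lp.norm_def, h, ENNReal.toReal_ofReal (by positivity)]
  have h0 : 0 ≤ ∫ x, ‖f x‖ ^ 2 := by positivity
  simp only [ENNReal.toReal_ofNat, Real.rpow_ofNat]
  rw [← Real.rpow_natCast, ← Real.rpow_mul h0]
  norm_num

theorem norm_sq_weakDeriv (f : Lp ℂ 2 (volume : Measure E)) (hf : MemH1 f) (m : E) :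
    Integrable (fun k => (2 * Real.pi * inner ℝ k m) ^ 2
        * ‖(𝓕 f : Lp ℂ 2 (volume : Measure E)) k‖ ^ 2) ∧
      ‖weakDeriv f hf m‖ ^ 2 = ∫ k, (2 * Real.pi * inner ℝ k m) ^ 2
        * ‖(𝓕 f : Lp ℂ 2 (volume : Measure E)) k‖ ^ 2 := by
  have h : (fun k => ‖(𝓕 (weakDeriv f hf m) : Lp ℂ 2 (volume : Measure E)) k‖ ^ 2) =ᵐ[volume]
      (fun k => (2 * Real.pi * inner ℝ k m) ^ 2
        * ‖(𝓕 f : Lp ℂ 2 (volume : Measure E)) k‖ ^ 2) := by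
    filter_upwards [fourier_weakDeriv f hf m] with k hk
    rw [hk]
    simp [mul_pow, abs_of_pos Real.pi_pos]
  refine ⟨((Lp.memLp _).integrable_norm_pow (by norm_num)).congr h, ?_⟩
  rw [← integral_congr_ae h, ← Lp.norm_fourier_eq, norm_sq_eq_integral]

theorem continuous_fourierInv_of_integrable {w : E → ℂ} (hw : Integrable w) :
    Continuous (𝓕⁻ w) := by
  have h : 𝓕⁻ w = 𝓕 (fun k : E => w (-k)) := by
    ext x
    rw [Real.fourierInv_eq_fourier_comp_neg]
  rw [h]
  exact VectorFourier.fourierIntegral_continuous Real.continuous_fourierChar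
    continuous_inner hw.comp_neg

/-- The L² transform is defined by extension, so the pointwise inversion integral is recovered by
pairing with Schwartz functions and moving the transform across by Fubini. -/
theorem ae_eq_fourierInv (f : Lp ℂ 2 (volume : Measure E))
    (hf : Integrable (𝓕 f : Lp ℂ 2 (volume : Measure E))) :
    f =ᵐ[volume] 𝓕⁻ ((𝓕 f : Lp ℂ 2 (volume : Measure E)) : E → ℂ) := by
  set w := (𝓕 f : Lp ℂ 2 (volume : Measure E)) with hw
  have hc : Continuous (𝓕⁻ (w : E → ℂ)) := continuous_fourierInv_of_integrable hf
  apply ae_eq_of_integral_schwartz_eq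
  · exact (Lp.memLp _).locallyIntegrable (by norm_num)
  · exact hc.locallyIntegrable
  · intro h
    have h1 : (f : 𝓢'(E, ℂ)) h = (w : 𝓢'(E, ℂ)) (𝓕⁻ h) := by
      rw [hw, ← Lp.fourier_toTemperedDistribution_eq, TemperedDistribution.fourier_apply,
        FourierTransform.fourier_fourierInv_eq]
    rw [Lp.toTemperedDistribution_apply, Lp.toTemperedDistribution_apply] at h1
    have h2 : ∫ k, (𝓕⁻ h) k • w k = ∫ k, 𝓕 (h : E → ℂ) k • w (-k) := by
      rw [← integral_neg_eq_self]
      congr 1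
      ext k
      rw [SchwartzMap.fourierInv_coe, Real.fourierInv_eq_fourier_neg, neg_neg]
    have h3 : ∫ k, 𝓕 (h : E → ℂ) k • w (-k)
        = ∫ x, h x • 𝓕 (fun k : E => w (-k)) x := by
      have h5 := VectorFourier.integral_fourierIntegral_smul_eq_flip (L := innerₗ E)
        (μ := (volume : Measure E)) (ν := (volume : Measure E))
        Real.continuous_fourierChar continuous_inner h.integrable hf.comp_neg
      rw [flip_innerₗ] at h5
      exact h5
    have h4 : ∀ x, 𝓕 (fun k : E => w (-k)) x = 𝓕⁻ (w : E → ℂ) x := by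
      intro x
      rw [Real.fourierInv_eq_fourier_comp_neg]
    simp only [h4] at h3
    exact h1.trans (h2.trans h3)

theorem ae_norm_le_integral_norm_fourier (f : Lp ℂ 2 (volume : Measure E))
    (hf : Integrable (𝓕 f : Lp ℂ 2 (volume : Measure E))) :
    ∀ᵐ x, ‖f x‖ ≤ ∫ k, ‖(𝓕 f : Lp ℂ 2 (volume : Measure E)) k‖ := by
  filter_upwards [ae_eq_fourierInv f hf] with x hx
  rw [hx]
  exact VectorFourier.norm_fourierIntegral_le_integral_norm _ _ _ _ _

end Fourier

/-! ### Gagliardo–Nirenberg by frequency splitting at each level. -/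

section LevelSet

variable {E : Type*} [NormedAddCommGroup E] [InnerProductSpace ℝ E] [FiniteDimensional ℝ E]
  [MeasurableSpace E] [BorelSpace E]

theorem setIntegral_norm_le_sqrt_mul_norm (w : Lp ℂ 2 (volume : Measure E)) {S : Set E}
    (hSf : volume S ≠ ⊤) :
    IntegrableOn w S ∧ ∫ k in S, ‖w k‖ ≤ √(volume.real S) * ‖w‖ := by
  have hw : MemLp w 2 (volume.restrict S) := (Lp.memLp w).restrict S
  have : IsFiniteMeasure (volume.restrict S) := ⟨by simpa using hSf.lt_top⟩
  have hi : IntegrableOn w S := hw.integrable (by norm_num)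
  refine ⟨hi, ?_⟩
  have h1 : eLpNorm w 1 (volume.restrict S) ≤ eLpNorm w 2 volume * (volume S) ^ (1 / 2 : ℝ) := by
    refine (eLpNorm_le_eLpNorm_mul_rpow_measure_univ (p := 1) (q := 2) (by norm_num) hw.1).trans ?_
    have h2 : (1 : ℝ) / (1 : ℝ≥0∞).toReal - 1 / (2 : ℝ≥0∞).toReal = 1 / 2 := by norm_num
    rw [h2, Measure.restrict_apply_univ]
    exact mul_le_mul_left (eLpNorm_restrict_le _ _ _ _) _
  rw [integral_norm_eq_lintegral_enorm hw.1, ← eLpNorm_one_eq_lintegral_enorm]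
  refine (ENNReal.toReal_mono ?_ h1).trans_eq ?_
  · exact ENNReal.mul_ne_top (Lp.eLpNorm_ne_top w) (by simp [hSf])
  · rw [ENNReal.toReal_mul, ← Lp.norm_def, mul_comm, ← ENNReal.toReal_rpow, Real.sqrt_eq_rpow]
    rfl

/-- Split f into the frequencies in S and the rest. Cauchy–Schwarz bounds the first part by t/2
almost everywhere, so where |f| > t the second part is at least t/2; Chebyshev and Plancherel
finish. -/
theorem measure_norm_gt_le (f : Lp ℂ 2 (volume : Measure E)) {S : Set E}
    (hS : MeasurableSet S) (hSf : volume S ≠ ⊤) {t : ℝ} (ht : 0 < t)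
    (h : √(volume.real S) * ‖f‖ ≤ t / 2) :
    volume {x | t < ‖f x‖} ≤ ENNReal.ofReal (4 / t ^ 2) *
      ∫⁻ k in Sᶜ, ‖(𝓕 f : Lp ℂ 2 (volume : Measure E)) k‖ₑ ^ 2 := by
  set w := (𝓕 f : Lp ℂ 2 (volume : Measure E)) with hw
  have hmem : MemLp (S.indicator w) 2 := (Lp.memLp w).indicator hS
  set lo : Lp ℂ 2 (volume : Measure E) := 𝓕⁻ (hmem.toLp _) with hlo
  have hFlo : 𝓕 lo = hmem.toLp _ := by rw [hlo, FourierTransform.fourier_fourierInv_eq]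
  have hlo_int : Integrable (𝓕 lo : Lp ℂ 2 (volume : Measure E)) := by
    rw [hFlo]
    refine Integrable.congr ?_ hmem.coeFn_toLp.symm
    exact (setIntegral_norm_le_sqrt_mul_norm w hSf).1.integrable_indicator hS
  have hlo_le : ∀ᵐ x, ‖lo x‖ ≤ t / 2 := by
    filter_upwards [ae_norm_le_integral_norm_fourier lo hlo_int] with x hx
    refine hx.trans (le_trans (le_of_eq ?_) (((setIntegral_norm_le_sqrt_mul_norm w hSf).2).trans
      (by rwa [hw, Lp.norm_fourier_eq])))
    rw [hFlo, ← integral_indicator hS]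
    apply integral_congr_ae
    filter_upwards [hmem.coeFn_toLp] with k hk
    rw [hk, norm_indicator_eq_indicator_norm]
  have hsub : volume {x | t < ‖f x‖} ≤ volume {x | ENNReal.ofReal (t / 2) ≤ ‖(f - lo) x‖ₑ} := by
    apply measure_mono_ae
    filter_upwards [hlo_le, Lp.coeFn_sub f lo] with x hx hx' hlt
    change t < ‖f x‖ at hlt
    change ENNReal.ofReal (t / 2) ≤ ‖(f - lo) x‖ₑ
    rw [hx', ← ofReal_norm]
    apply ENNReal.ofReal_le_ofReal
    have := norm_sub_norm_le (f x) (lo x)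
    simp only [Pi.sub_apply]
    linarith
  have hF : (𝓕 (f - lo) : Lp ℂ 2 (volume : Measure E)) = w - hmem.toLp _ := by
    rw [← hFlo]
    exact (Lp.fourierTransformₗᵢ E ℂ).map_sub f lo
  have hnorm : eLpNorm (f - lo : Lp ℂ 2 (volume : Measure E)) 2 volume ^ (2 : ℝ)
      = ∫⁻ k in Sᶜ, ‖w k‖ₑ ^ 2 := by
    have h1 : eLpNorm (f - lo : Lp ℂ 2 (volume : Measure E)) 2 volume
        = eLpNorm (𝓕 (f - lo) : Lp ℂ 2 (volume : Measure E)) 2 volume := by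
      rw [← Lp.enorm_def, ← Lp.enorm_def, ← ofReal_norm, ← ofReal_norm,
        Lp.norm_fourier_eq]
    have h2 : (𝓕 (f - lo) : Lp ℂ 2 (volume : Measure E)) =ᵐ[volume] Sᶜ.indicator w := by
      rw [hF]
      filter_upwards [Lp.coeFn_sub w (hmem.toLp _), hmem.coeFn_toLp] with k h1 h2
      rw [h1, Pi.sub_apply, h2]
      by_cases hk : k ∈ S <;> simp [hk]
    rw [h1, eLpNorm_congr_ae h2, eLpNorm_indicator_eq_eLpNorm_restrict hS.compl,
      eLpNorm_eq_lintegral_rpow_enorm_toReal (by norm_num) (by norm_num), ← ENNReal.rpow_mul]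
    norm_num
  refine hsub.trans ((meas_ge_le_mul_pow_eLpNorm_enorm volume (p := 2) (by norm_num) (by norm_num)
    (Lp.aestronglyMeasurable _) (by simpa using ht) (by simp)).trans (le_of_eq ?_))
  rw [ENNReal.toReal_ofNat, hnorm, ← ENNReal.ofReal_inv_of_pos (by positivity),
    ENNReal.ofReal_rpow_of_pos (by positivity)]
  congr 2
  norm_num
  field_simp
  norm_num

theorem lintegral_rpow_Ioc {τ s : ℝ} (hτ : 0 ≤ τ) (hs : -1 < s) :
    ∫⁻ t in Set.Ioc 0 τ, ENNReal.ofReal (t ^ s) = ENNReal.ofReal (τ ^ (s + 1) / (s + 1)) := by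
  rw [← ofReal_integral_eq_lintegral_ofReal, ← intervalIntegral.integral_of_le hτ,
    integral_rpow (Or.inl hs), Real.zero_rpow (by linarith), sub_zero]
  · rw [← IntegrableOn, ← intervalIntegrable_iff_integrableOn_Ioc_of_le hτ]
    exact intervalIntegral.intervalIntegrable_rpow' hs
  · filter_upwards [ae_restrict_mem measurableSet_Ioc] with t ht
    exact Real.rpow_nonneg ht.1.le _

/-- A Gagliardo–Nirenberg inequality in terms of the Fourier transform. -/
theorem lintegral_norm_rpow_le [Nontrivial E] {p : ℝ} (hp : 2 < p) :
    ∃ C : ℝ, 0 ≤ C ∧ ∀ f : Lp ℂ 2 (volume : Measure E),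
      ∫⁻ x, ENNReal.ofReal (‖f x‖ ^ p) ≤ ENNReal.ofReal (C * ‖f‖ ^ (p - 2)) *
        ∫⁻ k, ENNReal.ofReal (‖k‖ ^ (Module.finrank ℝ E * (p - 2) / 2)) *
          ‖(𝓕 f : Lp ℂ 2 (volume : Measure E)) k‖ₑ ^ 2 := by
  set d := Module.finrank ℝ E with hd
  have hd0 : 0 < (d : ℝ) := by exact_mod_cast Module.finrank_pos
  set V := volume.real (Metric.ball (0 : E) 1) with hV
  have hV0 : 0 ≤ V := measureReal_nonneg
  have hV1 : 0 < V := by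
    rw [hV, measureReal_def]
    exact ENNReal.toReal_pos (Metric.measure_ball_pos _ _ one_pos).ne' measure_ball_lt_top.ne
  refine ⟨4 * p / (p - 2) * (2 * √V) ^ (p - 2), by
    have : 0 < p - 2 := by linarith
    positivity, fun f => ?_⟩
  set w := (𝓕 f : Lp ℂ 2 (volume : Measure E)) with hw
  rcases eq_or_ne f 0 with rfl | hf
  · have : ∫⁻ x, ENNReal.ofReal (‖(0 : Lp ℂ 2 (volume : Measure E)) x‖ ^ p) = 0 := by
      rw [← lintegral_zero (μ := (volume : Measure E))]
      apply lintegral_congr_ae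
      filter_upwards [Lp.coeFn_zero ℂ 2 (volume : Measure E)] with x hx
      rw [hx]
      simp [Real.zero_rpow (by linarith : p ≠ 0)]
    rw [this]
    exact zero_le
  have hN : 0 < ‖f‖ := norm_pos_iff.mpr hf
  set N := ‖f‖ with hNdef
  -- Chosen so that {τ < t} lies in a ball of volume (t / (2N))², which is exactly what makes the
  -- low-frequency part at most t/2. Dividing by N is why f = 0 was treated apart.
  set τ : E → ℝ := fun k => 2 * √V * N * ‖k‖ ^ (d / 2 : ℝ) with hτ
  have hτm : Measurable τ := by
    apply Measurable.const_mul
    exact measurable_norm.pow_const _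
  have hτ0 : ∀ k, 0 ≤ τ k := fun k => by positivity
  have hlevel : ∀ t : ℝ, 0 < t → volume {x | t < ‖f x‖} ≤ ENNReal.ofReal (4 / t ^ 2) *
      ∫⁻ k, (Set.Iic (τ k)).indicator 1 t * ‖w k‖ₑ ^ 2 := by
    intro t ht
    set S : Set E := {k | τ k < t} with hS
    have hSm : MeasurableSet S := measurableSet_lt hτm measurable_const
    set A : ℝ := (t / (2 * √V * N)) ^ (2 / d : ℝ) with hA
    have hA0 : 0 < A := by positivity
    have hSA : S ⊆ Metric.ball 0 A := by
      intro k hk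
      rw [mem_ball_zero_iff, hA]
      have h1 : ‖k‖ ^ (d / 2 : ℝ) < t / (2 * √V * N) := by
        rw [lt_div_iff₀ (by positivity), mul_comm]
        exact hk
      have h2 : ‖k‖ = (‖k‖ ^ (d / 2 : ℝ)) ^ (2 / d : ℝ) := by
        rw [← Real.rpow_mul (norm_nonneg _)]
        field_simp
        simp
      rw [h2]
      exact Real.rpow_lt_rpow (by positivity) h1 (by positivity)
    have hvol : volume (Metric.ball (0 : E) A) = ENNReal.ofReal (A ^ d * V) := by
      rw [Measure.addHaar_ball _ _ hA0.le, ENNReal.ofReal_mul (by positivity), hV,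
        ofReal_measureReal measure_ball_lt_top.ne]
    have hSf : volume S ≠ ⊤ := ((measure_mono hSA).trans_lt measure_ball_lt_top).ne
    have hAd : A ^ d * V = (t / (2 * N)) ^ 2 := by
      have h1 : A ^ d = (t / (2 * √V * N)) ^ 2 := by
        rw [hA, ← Real.rpow_natCast, ← Real.rpow_mul (by positivity), div_mul_cancel₀ _ hd0.ne',
          Real.rpow_two]
      rw [h1, div_pow, mul_pow, mul_pow, Real.sq_sqrt hV0]
      field_simp
    have hle : √(volume.real S) * N ≤ t / 2 := by
      have h1 : volume.real S ≤ (t / (2 * N)) ^ 2 := by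
        rw [← hAd, measureReal_def]
        apply ENNReal.toReal_le_of_le_ofReal (by positivity)
        rw [← hvol]
        exact measure_mono hSA
      have h2 : √(volume.real S) ≤ t / (2 * N) := by
        rw [Real.sqrt_le_left (by positivity)]
        exact h1
      calc √(volume.real S) * N ≤ t / (2 * N) * N := by gcongr
        _ = t / 2 := by field_simp
    refine (measure_norm_gt_le f hSm hSf ht hle).trans_eq ?_
    rw [← lintegral_indicator hSm.compl]
    congr 2
    ext k
    by_cases hk : τ k < t
    · simp [hS, hk]
    · simp [hS, hk, not_lt.mp hk, hw]
  -- Layer cake, then Tonelli: for fixed k the level t runs over (0, τ k], and the integral of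
  -- t^(p-3) converges at 0 because p > 2. The resulting τ^(p-2) produces the weight ‖k‖^(d(p-2)/2).
  rw [lintegral_rpow_eq_lintegral_meas_lt_mul volume (Filter.Eventually.of_forall
    fun x => norm_nonneg _) (Lp.aestronglyMeasurable f).norm.aemeasurable (by linarith)]
  have hwm : AEMeasurable (fun k => ‖w k‖ₑ ^ 2) volume :=
    (Lp.aestronglyMeasurable w).enorm.pow_const 2
  have hind : Measurable fun z : ℝ × E => (Set.Iic (τ z.2)).indicator (1 : ℝ → ℝ≥0∞) z.1 :=
    (measurable_one (α := ℝ≥0∞) (β := ℝ × E)).indicator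
      (measurableSet_le measurable_fst (hτm.comp measurable_snd))
  calc ENNReal.ofReal p * ∫⁻ t in Set.Ioi 0, volume {x | t < ‖f x‖} * ENNReal.ofReal (t ^ (p - 1))
      ≤ ENNReal.ofReal p * ∫⁻ t in Set.Ioi (0 : ℝ), ∫⁻ k, ENNReal.ofReal (4 * t ^ (p - 3)) *
        ((Set.Iic (τ k)).indicator 1 t * ‖w k‖ₑ ^ 2) := by
        refine mul_le_mul_right ?_ _
        apply setLIntegral_mono' measurableSet_Ioi
        intro t ht
        have ht : 0 < t := ht
        rw [lintegral_const_mul'' _ (by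
          refine AEMeasurable.mul ?_ hwm
          exact (hind.comp (measurable_const (a := t) |>.prodMk measurable_id)).aemeasurable)]
        calc _ ≤ ENNReal.ofReal (4 / t ^ 2) * (∫⁻ k, (Set.Iic (τ k)).indicator 1 t * ‖w k‖ₑ ^ 2)
              * ENNReal.ofReal (t ^ (p - 1)) := mul_le_mul_left (hlevel t ht) _
          _ = (ENNReal.ofReal (4 / t ^ 2) * ENNReal.ofReal (t ^ (p - 1))) *
              (∫⁻ k, (Set.Iic (τ k)).indicator 1 t * ‖w k‖ₑ ^ 2) := by ring
          _ = _ := by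
            rw [← ENNReal.ofReal_mul (by positivity)]
            congr 2
            rw [show p - 1 = (p - 3) + (2 : ℕ) by push_cast; ring, Real.rpow_add ht,
              Real.rpow_natCast]
            field_simp
    _ = ENNReal.ofReal p * ∫⁻ k, ∫⁻ t in Set.Ioi (0 : ℝ), ENNReal.ofReal (4 * t ^ (p - 3)) *
        ((Set.Iic (τ k)).indicator 1 t * ‖w k‖ₑ ^ 2) := by
        rw [lintegral_lintegral_swap]
        apply AEMeasurable.mul
        · exact (by fun_prop : Measurable fun z : ℝ × E =>
            ENNReal.ofReal (4 * z.1 ^ (p - 3))).aemeasurable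
        · apply AEMeasurable.mul
          · exact hind.aemeasurable
          · exact hwm.comp_snd
    _ = ENNReal.ofReal p * ∫⁻ k, ENNReal.ofReal (4 / (p - 2) * (2 * √V) ^ (p - 2) * N ^ (p - 2)) *
          (ENNReal.ofReal (‖k‖ ^ (d * (p - 2) / 2)) * ‖w k‖ₑ ^ 2) := by
        congr 2
        ext k
        calc _ = ∫⁻ t in Set.Ioi (0 : ℝ), (Set.Iic (τ k)).indicator
                (fun t => ENNReal.ofReal (t ^ (p - 3))) t * (ENNReal.ofReal 4 * ‖w k‖ₑ ^ 2) := by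
              congr 1
              ext t
              by_cases h : t ≤ τ k
              · simp only [Set.mem_Iic, h, Set.indicator_of_mem, Pi.one_apply, one_mul]
                rw [ENNReal.ofReal_mul (by norm_num)]
                ring
              · simp [h]
          _ = (∫⁻ t in Set.Ioc 0 (τ k), ENNReal.ofReal (t ^ (p - 3))) *
                (ENNReal.ofReal 4 * ‖w k‖ₑ ^ 2) := by
              rw [lintegral_mul_const' _ _ (by finiteness), lintegral_indicator measurableSet_Iic,
                Measure.restrict_restrict measurableSet_Iic, Set.Iic_inter_Ioi]
          _ = _ := by
              rw [lintegral_rpow_Ioc (hτ0 k) (by linarith), ← mul_assoc, ← mul_assoc]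
              congr 1
              rw [← ENNReal.ofReal_mul (by
                have := hτ0 k
                have : 0 < p - 3 + 1 := by linarith
                positivity), ← ENNReal.ofReal_mul (by
                have : 0 < p - 2 := by linarith
                positivity)]
              congr 1
              have h1 : τ k ^ (p - 2) = (2 * √V) ^ (p - 2) * N ^ (p - 2) *
                  ‖k‖ ^ (d * (p - 2) / 2) := by
                rw [hτ, Real.mul_rpow (by positivity) (by positivity),
                  Real.mul_rpow (by positivity) (by positivity), ← Real.rpow_mul (norm_nonneg _)]
                congr 2
                ring
              rw [show p - 3 + 1 = p - 2 by ring, h1]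
              ring
    _ = _ := by
        rw [lintegral_const_mul'' _ (by fun_prop), ← mul_assoc, ← ENNReal.ofReal_mul (by linarith)]
        congr 2
        ring

end LevelSet

/-! ### The Green function and its Fourier transform. -/

section Macdonald

theorem integral_exp_neg_norm_sq_div {t : ℝ} (ht : 0 < t) :
    ∫ x : Plane, Real.exp (-t - ‖x‖ ^ 2 / (4 * t)) / t = 4 * Real.pi * Real.exp (-t) := by
  have h := GaussianFourier.integral_rexp_neg_mul_sq_norm (V := Plane) (b := 1 / (4 * t))
    (by positivity)
  have h2 : ∀ x : Plane, Real.exp (-t - ‖x‖ ^ 2 / (4 * t)) / t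
      = Real.exp (-t) / t * Real.exp (-(1 / (4 * t)) * ‖x‖ ^ 2) := by
    intro x
    rw [div_mul_eq_mul_div, ← Real.exp_add]
    congr 2
    ring
  simp_rw [h2]
  rw [integral_const_mul, h]
  simp
  field_simp

theorem integrable_exp_neg_norm_sq_div {t : ℝ} (ht : 0 < t) :
    Integrable (fun x : Plane => Real.exp (-t - ‖x‖ ^ 2 / (4 * t)) / t) := by
  -- The Bochner integral of a non-integrable function is 0, so the positive value already computed
  -- forces integrability.
  by_contra h
  have := integral_exp_neg_norm_sq_div ht
  rw [integral_undef h] at this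
  have : 0 < 4 * Real.pi * Real.exp (-t) := by positivity
  linarith

theorem integrable_macdonaldK0_prod :
    Integrable (fun z : Plane × ℝ => Real.exp (-z.2 - ‖z.1‖ ^ 2 / (4 * z.2)) / z.2)
      ((volume : Measure Plane).prod (volume.restrict (Set.Ioi (0 : ℝ)))) := by
  rw [integrable_prod_iff' (by
    apply Measurable.aestronglyMeasurable
    fun_prop)]
  constructor
  · filter_upwards [ae_restrict_mem measurableSet_Ioi] with t ht
    exact integrable_exp_neg_norm_sq_div ht
  · have : Integrable (fun t : ℝ => 4 * Real.pi * Real.exp (-t))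
        (volume.restrict (Set.Ioi (0 : ℝ))) :=
      (integrableOn_exp_neg_Ioi 0).const_mul _
    refine this.congr ?_
    filter_upwards [ae_restrict_mem measurableSet_Ioi] with t ht
    have ht : 0 < t := ht
    rw [← integral_exp_neg_norm_sq_div ht]
    congr 1
    ext x
    rw [Real.norm_of_nonneg (by positivity)]

/-- The Green function `K₀(|x|) / (2π)` of `1 - Δ` on the plane. -/
def green (x : Plane) : ℂ := ((macdonaldK0 ‖x‖ / (2 * Real.pi) : ℝ) : ℂ)

theorem integrable_green : Integrable green := by
  have h := integrable_macdonaldK0_prod.integral_prod_left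
  exact ((h.const_mul (1 / 2)).div_const (2 * Real.pi)).ofReal

/-- The defining integral writes K₀ as a superposition of Gaussians. Transforming each one leaves
exp(-(1 + 4π²|k|²)t), whose integral over t > 0 is the claimed inverse. -/
theorem fourier_green (k : Plane) :
    𝓕 green k = ((1 + (2 * Real.pi * ‖k‖) ^ 2)⁻¹ : ℝ) := by
  have hg : ∀ x : Plane, green x = ∫ t in Set.Ioi (0 : ℝ),
      (1 / (4 * Real.pi) : ℂ) * ((Real.exp (-t - ‖x‖ ^ 2 / (4 * t)) / t : ℝ) : ℂ) := by
    intro x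
    rw [integral_const_mul, integral_complex_ofReal, green, macdonaldK0]
    set I := ∫ t in Set.Ioi (0 : ℝ), Real.exp (-t - ‖x‖ ^ 2 / (4 * t)) / t
    push_cast
    ring
  have h1 : ∀ x : Plane, 𝐞 (-inner ℝ x k) • green x = ∫ t in Set.Ioi (0 : ℝ),
      𝐞 (-inner ℝ x k) •
      ((1 / (4 * Real.pi) : ℂ) * ((Real.exp (-t - ‖x‖ ^ 2 / (4 * t)) / t : ℝ) : ℂ)) := by
    intro x
    rw [hg, Circle.smul_def, ← integral_smul]
    rfl
  rw [Real.fourier_eq]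
  simp_rw [h1]
  rw [integral_integral_swap]
  · have h2 : ∀ t ∈ Set.Ioi (0 : ℝ), ∫ x : Plane, 𝐞 (-inner ℝ x k) •
        ((1 / (4 * Real.pi) : ℂ) * ((Real.exp (-t - ‖x‖ ^ 2 / (4 * t)) / t : ℝ) : ℂ))
        = ((Real.exp (-(1 + (2 * Real.pi * ‖k‖) ^ 2) * t) : ℝ) : ℂ) := by
      intro t ht
      have ht : 0 < t := ht
      have h3 := fourier_gaussian_innerProductSpace (V := Plane) (b := ((1 / (4 * t) : ℝ) : ℂ))
        (by rw [Complex.ofReal_re]; positivity) k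
      rw [Real.fourier_eq] at h3
      have h4 : ∀ x : Plane, 𝐞 (-inner ℝ x k) •
          ((1 / (4 * Real.pi) : ℂ) * ((Real.exp (-t - ‖x‖ ^ 2 / (4 * t)) / t : ℝ) : ℂ))
          = ((Real.exp (-t) / (4 * Real.pi * t) : ℝ) : ℂ) * 𝐞 (-inner ℝ x k) •
            Complex.exp (-((1 / (4 * t) : ℝ) : ℂ) * ‖x‖ ^ 2) := by
        intro x
        rw [mul_smul_comm]
        congr 1
        rw [sub_eq_add_neg, Real.exp_add]
        push_cast
        field_simp
      simp_rw [h4]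
      rw [integral_const_mul, h3]
      have ht' : (t : ℂ) ≠ 0 := by exact_mod_cast ht.ne'
      have hpi : (Real.pi : ℂ) ≠ 0 := by exact_mod_cast Real.pi_ne_zero
      simp only [finrank_euclideanSpace, Fintype.card_fin, Nat.cast_ofNat]
      rw [div_self (by norm_num), Complex.cpow_one]
      have h5 : Real.exp (-(1 + (2 * Real.pi * ‖k‖) ^ 2) * t)
          = Real.exp (-t) * Real.exp (-Real.pi ^ 2 * ‖k‖ ^ 2 * (4 * t)) := by
        rw [← Real.exp_add]
        congr 1
        ring
      rw [h5]
      push_cast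
      field_simp
    rw [setIntegral_congr_fun measurableSet_Ioi h2, integral_complex_ofReal,
      integral_exp_mul_Ioi (by nlinarith [sq_nonneg (2 * Real.pi * ‖k‖)])]
    rw [mul_zero, Real.exp_zero, neg_div_neg_eq, one_div]
  · have h := (integrable_macdonaldK0_prod.ofReal (𝕜 := ℂ)).const_mul (1 / (4 * Real.pi) : ℂ)
    refine h.mono ?_ ?_
    · apply AEStronglyMeasurable.fun_smul
      · apply Continuous.aestronglyMeasurable
        fun_prop
      · exact h.aestronglyMeasurable
    · filter_upwards with z
      simp [Function.uncurry]

theorem fourier_of_decomp {v φ : Lp ℂ 2 (volume : Measure Plane)} {q : ℂ}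
    (h : ∀ᵐ x : Plane, v x = φ x + q * green x) :
    ∀ᵐ k, (𝓕 v : Lp ℂ 2 (volume : Measure Plane)) k = (𝓕 φ : Lp ℂ 2 (volume : Measure Plane)) k
      + q * ((1 + (2 * Real.pi * ‖k‖) ^ 2)⁻¹ : ℝ) := by
  have hc : Continuous fun k : Plane => q * (((1 + (2 * Real.pi * ‖k‖) ^ 2)⁻¹ : ℝ) : ℂ) := by
    have : ∀ k : Plane, 1 + (2 * Real.pi * ‖k‖) ^ 2 ≠ 0 := fun k => by positivity
    fun_prop (disch := assumption)
  have hd : (𝓕 (v - φ) : Lp ℂ 2 (volume : Measure Plane)) =ᵐ[volume]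
      fun k : Plane => q * (((1 + (2 * Real.pi * ‖k‖) ^ 2)⁻¹ : ℝ) : ℂ) := by
    apply ae_eq_of_integral_schwartz_eq
    · exact (Lp.memLp _).locallyIntegrable (by norm_num)
    · exact hc.locallyIntegrable
    · intro η
      rw [← Lp.toTemperedDistribution_apply, ← Lp.fourier_toTemperedDistribution_eq,
        TemperedDistribution.fourier_apply, Lp.toTemperedDistribution_apply]
      have h1 : ∫ x, (𝓕 η) x • (v - φ : Lp ℂ 2 (volume : Measure Plane)) x
          = ∫ x, 𝓕 (η : Plane → ℂ) x • (q * green x) := by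
        apply integral_congr_ae
        filter_upwards [h, Lp.coeFn_sub v φ] with x hx hx'
        rw [hx', Pi.sub_apply, hx, SchwartzMap.fourier_coe]
        simp
      rw [h1]
      have h5 := VectorFourier.integral_fourierIntegral_smul_eq_flip (L := innerₗ Plane)
        (μ := (volume : Measure Plane)) (ν := (volume : Measure Plane))
        Real.continuous_fourierChar continuous_inner η.integrable (integrable_green.const_mul q)
      rw [flip_innerₗ] at h5
      refine Eq.trans h5 ?_
      congr 1
      ext k
      congr 1
      rw [← fourier_green]
      exact congrFun (VectorFourier.fourierIntegral_const_smul 𝐞 volume (innerₗ Plane) green q) k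
  have hsub : (𝓕 (v - φ) : Lp ℂ 2 (volume : Measure Plane)) = 𝓕 v - 𝓕 φ :=
    (Lp.fourierTransformₗᵢ Plane ℂ).map_sub v φ
  rw [hsub] at hd
  filter_upwards [hd, Lp.coeFn_sub (𝓕 v : Lp ℂ 2 (volume : Measure Plane)) (𝓕 φ)] with k h1 h2
  rw [← h1, h2]
  simp

end Macdonald

/-! ### The symbol of 1 - Δ and the logarithmic divergence on the plane. -/

section Symbol

variable {E : Type*} [NormedAddCommGroup E]

/-- The Fourier symbol `1 + 4π²|k|²` of `1 - Δ`. -/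
def symbol (k : E) : ℝ := 1 + (2 * Real.pi * ‖k‖) ^ 2

theorem one_le_symbol (k : E) : 1 ≤ symbol k := by
  have := sq_nonneg (2 * Real.pi * ‖k‖)
  unfold symbol
  linarith

theorem symbol_pos (k : E) : 0 < symbol k := one_pos.trans_le (one_le_symbol k)

@[fun_prop]
theorem measurable_symbol [MeasurableSpace E] [OpensMeasurableSpace E] :
    Measurable (symbol : E → ℝ) := by
  unfold symbol
  fun_prop

theorem one_add_norm_sq_le_symbol (k : E) : 1 + ‖k‖ ^ 2 ≤ symbol k := by
  have : 1 ≤ (2 * Real.pi) ^ 2 := by nlinarith [Real.pi_gt_three]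
  unfold symbol
  rw [mul_pow]
  nlinarith [sq_nonneg ‖k‖]

theorem integrable_symbol_rpow_neg [InnerProductSpace ℝ E] [FiniteDimensional ℝ E]
    [MeasurableSpace E] [BorelSpace E] {s : ℝ} (hs : (Module.finrank ℝ E : ℝ) < 2 * s) :
    Integrable fun k : E => symbol k ^ (-s) := by
  have h := integrable_rpow_neg_one_add_norm_sq (E := E) (μ := volume) hs
  refine h.mono' (measurable_symbol.pow_const _).aestronglyMeasurable
    (Filter.Eventually.of_forall fun k => ?_)
  have hs0 : 0 ≤ s := by
    have : (0 : ℝ) ≤ Module.finrank ℝ E := Nat.cast_nonneg _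
    linarith
  rw [Real.norm_of_nonneg (Real.rpow_nonneg (symbol_pos k).le _), neg_div,
    mul_div_cancel_left₀ _ (by norm_num)]
  exact Real.rpow_le_rpow_of_nonpos (by positivity) (one_add_norm_sq_le_symbol k) (by linarith)

/-- In polar coordinates the integrand y / (1 + 4π²y²) is comparable to 1/y at infinity. -/
theorem lintegral_inv_symbol_plane :
    ∫⁻ k : Plane, ENNReal.ofReal (symbol k)⁻¹ = ⊤ := by
  by_contra h
  have hint : Integrable fun k : Plane => (symbol k)⁻¹ := by
    refine ⟨by fun_prop, ?_⟩
    rw [hasFiniteIntegral_iff_ofReal (Filter.Eventually.of_forall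
      fun k => inv_nonneg.mpr (symbol_pos k).le)]
    exact lt_top_iff_ne_top.mpr h
  have h1 := (integrable_fun_norm_addHaar (volume : Measure Plane)
    (f := fun y : ℝ => (1 + (2 * Real.pi * y) ^ 2)⁻¹)).mp hint
  simp only [finrank_euclideanSpace, Fintype.card_fin, Nat.add_one_sub_one, pow_one,
    smul_eq_mul] at h1
  have h2 : IntegrableOn (fun y : ℝ => y⁻¹) (Set.Ioi 1) := by
    have h3 := (h1.mono_set (Set.Ioi_subset_Ioi zero_le_one)).const_mul (1 + (2 * Real.pi) ^ 2)
    refine h3.mono' (by fun_prop) ?_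
    filter_upwards [ae_restrict_mem measurableSet_Ioi] with y hy
    have hy : 1 < y := hy
    rw [Real.norm_of_nonneg (by positivity), ← div_eq_mul_inv, ← mul_div_assoc,
      le_div_iff₀ (by positivity), mul_pow]
    field_simp
    nlinarith [Real.pi_pos]
  exact not_integrableOn_Ioi_inv h2

/-- R is the point where C x^θ and εx cross: below it the left side is at most C R^θ, above it εx
dominates. -/
theorem exists_mul_rpow_le {θ C ε : ℝ} (hθ : θ < 1) (hθ0 : 0 ≤ θ) (hC : 0 ≤ C) (hε : 0 < ε) :
    ∃ M : ℝ, 0 ≤ M ∧ ∀ x : ℝ, 0 < x → C * x ^ θ ≤ ε * x + M := by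
  set R := (C / ε) ^ (1 / (1 - θ)) with hR
  have hθ1 : 0 < 1 - θ := by linarith
  have hR0 : 0 ≤ R := by positivity
  refine ⟨C * R ^ θ, by positivity, fun x hx => ?_⟩
  rcases le_total x R with h | h
  · have : x ^ θ ≤ R ^ θ := Real.rpow_le_rpow hx.le h hθ0
    nlinarith
  · have h1 : C / ε ≤ x ^ (1 - θ) := by
      calc C / ε = R ^ (1 - θ) := by
            rw [hR, ← Real.rpow_mul (by positivity), one_div, inv_mul_cancel₀ hθ1.ne',
              Real.rpow_one]
        _ ≤ x ^ (1 - θ) := Real.rpow_le_rpow hR0 h hθ1.le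
    rw [div_le_iff₀ hε] at h1
    have h2 : x ^ (1 - θ) * x ^ θ = x := by
      rw [← Real.rpow_add hx]
      simp
    have h3 : 0 ≤ x ^ θ := by positivity
    have h4 : 0 ≤ C * R ^ θ := by positivity
    nlinarith

/-- For each M the difference of inverses is O(J^(θ-2)), integrable on the plane because θ < 1. As M
grows it increases to 1/J, which is not integrable, so monotone convergence makes its integral
exceed any B. -/
theorem exists_le_integral_inv_symbol_sub {C θ : ℝ} (hθ0 : 0 ≤ θ) (hθ : θ < 1) (hC : 0 ≤ C)
    (B : ℝ) : ∃ M : ℝ,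
      (∀ k : Plane, symbol k / 2 ≤ symbol k - 1 - C * symbol k ^ θ + M) ∧
      Integrable (fun k : Plane => (symbol k)⁻¹ - (symbol k - 1 - C * symbol k ^ θ + M)⁻¹) ∧
      B ≤ ∫ k : Plane, ((symbol k)⁻¹ - (symbol k - 1 - C * symbol k ^ θ + M)⁻¹) := by
  obtain ⟨M₀, hM₀, hyoung⟩ := exists_mul_rpow_le hθ hθ0 hC (ε := 1 / 2) (by norm_num)
  -- The 1 cancels the -1 and M₀ pays for C J^θ up to J/2, so a n ≥ J/2 for every n.
  set a : ℕ → Plane → ℝ := fun n k => symbol k - 1 - C * symbol k ^ θ + (M₀ + 1 + n) with ha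
  have ha_le : ∀ n k, symbol k / 2 ≤ a n k := by
    intro n k
    have h1 := hyoung (symbol k) (symbol_pos k)
    have h2 : (0 : ℝ) ≤ n := Nat.cast_nonneg n
    simp only [ha]
    linarith
  have ha_pos : ∀ n k, 0 < a n k := fun n k => (half_pos (symbol_pos k)).trans_le (ha_le n k)
  have ha_meas : ∀ n, Measurable (a n) := fun n => by fun_prop
  set D : ℕ → Plane → ℝ := fun n k => (symbol k)⁻¹ - (a n k)⁻¹ with hD
  have hDint : ∀ n, Integrable (D n) := by
    intro n
    have h := (integrable_symbol_rpow_neg (E := Plane) (s := 2 - θ)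
      (by rw [finrank_euclideanSpace, Fintype.card_fin]; push_cast; linarith)).const_mul
        (2 * (C + M₀ + n))
    refine h.mono' (by fun_prop) (Filter.Eventually.of_forall fun k => ?_)
    have hs := symbol_pos k
    have hs1 : 1 ≤ symbol k ^ θ := Real.one_le_rpow (one_le_symbol k) hθ0
    have hn : (0 : ℝ) ≤ n := Nat.cast_nonneg n
    have e1 : D n k = (a n k - symbol k) / (symbol k * a n k) := by
      have := (ha_pos n k).ne'
      simp only [hD]
      field_simp
    have e2 : |a n k - symbol k| ≤ (C + M₀ + n) * symbol k ^ θ := by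
      simp only [ha]
      rw [abs_le]
      constructor <;> nlinarith
    have e3 : symbol k ^ (-(2 - θ)) = symbol k ^ θ / symbol k ^ 2 := by
      rw [neg_sub, Real.rpow_sub hs, Real.rpow_two]
    rw [Real.norm_eq_abs, e1, abs_div, abs_of_pos (mul_pos hs (ha_pos n k)), e3]
    calc |a n k - symbol k| / (symbol k * a n k)
        ≤ (C + M₀ + n) * symbol k ^ θ / (symbol k * (symbol k / 2)) := by
          gcongr
          exact ha_le n k
      _ = 2 * (C + M₀ + n) * (symbol k ^ θ / symbol k ^ 2) := by
          field_simp
  have hmono : ∀ k, Monotone fun n => D n k := by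
    intro k m n hmn
    have : a m k ≤ a n k := by
      simp only [ha]
      gcongr
    have := inv_anti₀ (ha_pos m k) this
    simp only [hD]
    linarith
  have hlim : ∀ k, Filter.Tendsto (fun n => ENNReal.ofReal (D n k - D 0 k)) Filter.atTop
      (nhds (ENNReal.ofReal (a 0 k)⁻¹)) := by
    intro k
    apply ENNReal.tendsto_ofReal
    have h1 : Filter.Tendsto (fun n : ℕ => (a n k)⁻¹) Filter.atTop (nhds 0) := by
      apply Filter.Tendsto.inv_tendsto_atTop
      apply Filter.tendsto_atTop_add_const_left
      exact Filter.tendsto_atTop_add_const_left _ _ tendsto_natCast_atTop_atTop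
    have h2 : (fun n => D n k - D 0 k) = fun n => (a 0 k)⁻¹ - (a n k)⁻¹ := by
      ext n
      simp only [hD]
      ring
    rw [h2]
    simpa using h1.const_sub (a 0 k)⁻¹
  -- Subtracting D 0, which may be negative, gives nonnegative functions increasing to 1 / a 0; as a
  -- 0 ≤ (1 + M₀) J, the limit has infinite integral.
  have htend := lintegral_tendsto_of_tendsto_of_monotone (μ := (volume : Measure Plane))
    (f := fun n k => ENNReal.ofReal (D n k - D 0 k)) (F := fun k => ENNReal.ofReal (a 0 k)⁻¹)
    (fun n => ((hDint n).sub (hDint 0)).aestronglyMeasurable.aemeasurable.ennreal_ofReal)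
    (Filter.Eventually.of_forall fun k m n hmn =>
      ENNReal.ofReal_le_ofReal (sub_le_sub_right (hmono k hmn) _))
    (Filter.Eventually.of_forall hlim)
  have htop : ∫⁻ k : Plane, ENNReal.ofReal (a 0 k)⁻¹ = ⊤ := by
    have h1 : ∀ k : Plane, ENNReal.ofReal (1 + M₀)⁻¹ * ENNReal.ofReal (symbol k)⁻¹
        ≤ ENNReal.ofReal (a 0 k)⁻¹ := by
      intro k
      rw [← ENNReal.ofReal_mul (by positivity), ← mul_inv]
      apply ENNReal.ofReal_le_ofReal
      apply inv_anti₀ (ha_pos 0 k)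
      have h2 : 0 ≤ C * symbol k ^ θ := mul_nonneg hC (Real.rpow_nonneg (symbol_pos k).le _)
      have h3 := one_le_symbol k
      simp only [ha, Nat.cast_zero]
      nlinarith
    have h2 := lintegral_mono (μ := (volume : Measure Plane)) h1
    rw [lintegral_const_mul' _ _ ENNReal.ofReal_ne_top, lintegral_inv_symbol_plane,
      ENNReal.mul_top (by simp; linarith)] at h2
    exact top_le_iff.mp h2
  rw [htop] at htend
  have hev := htend.eventually (lt_mem_nhds (ENNReal.ofReal_lt_top (r := B - ∫ k, D 0 k)))
  obtain ⟨n, hn⟩ := hev.exists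
  have hsub : Integrable fun k => D n k - D 0 k := (hDint n).sub (hDint 0)
  rw [← ofReal_integral_eq_lintegral_ofReal hsub
    (Filter.Eventually.of_forall fun k => sub_nonneg.mpr (hmono k (Nat.zero_le n))),
    integral_sub (hDint n) (hDint 0)] at hn
  have hn' := (ENNReal.ofReal_lt_ofReal_iff'.mp hn).1
  exact ⟨M₀ + 1 + n, ha_le n, hDint n, by linarith⟩

end Symbol

/-! ### Lower bounds for the line and plane energies. -/

section Energy

variable {E : Type*} [NormedAddCommGroup E] [InnerProductSpace ℝ E] [FiniteDimensional ℝ E]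
  [MeasurableSpace E] [BorelSpace E]

theorem integrable_norm_sq (f : Lp ℂ 2 (volume : Measure E)) : Integrable fun x => ‖f x‖ ^ 2 :=
  (Lp.memLp f).integrable_norm_pow (by norm_num)

theorem integral_norm_fourier_sq (f : Lp ℂ 2 (volume : Measure E)) :
    ∫ k, ‖(𝓕 f : Lp ℂ 2 (volume : Measure E)) k‖ ^ 2 = ‖f‖ ^ 2 := by
  rw [← norm_sq_eq_integral, Lp.norm_fourier_eq]

theorem integrable_symbol_rpow_mul {w : Lp ℂ 2 (volume : Measure E)}
    (hw : Integrable fun k => symbol k * ‖w k‖ ^ 2) {θ : ℝ} (hθ : θ ≤ 1) :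
    Integrable fun k => symbol k ^ θ * ‖w k‖ ^ 2 := by
  refine hw.mono' ?_ (Filter.Eventually.of_forall fun k => ?_)
  · exact (measurable_symbol.pow_const θ).aestronglyMeasurable.mul
      ((Lp.aestronglyMeasurable w).norm.pow 2)
  · rw [Real.norm_of_nonneg (mul_nonneg (Real.rpow_nonneg (symbol_pos k).le _) (by positivity))]
    gcongr
    calc symbol k ^ θ ≤ symbol k ^ (1 : ℝ) :=
          Real.rpow_le_rpow_of_exponent_le (one_le_symbol k) hθ
      _ = symbol k := Real.rpow_one _

theorem memLp_and_integral_rpow_le [Nontrivial E] {p θ : ℝ} (hp : 2 < p)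
    (hθ : θ = Module.finrank ℝ E * (p - 2) / 4) :
    ∃ C : ℝ, 0 ≤ C ∧ ∀ f : Lp ℂ 2 (volume : Measure E),
      Integrable (fun k => symbol k ^ θ * ‖(𝓕 f : Lp ℂ 2 (volume : Measure E)) k‖ ^ 2) →
      MemLp f (ENNReal.ofReal p) ∧ ∫ x, ‖f x‖ ^ p ≤ C * ‖f‖ ^ (p - 2) *
        ∫ k, symbol k ^ θ * ‖(𝓕 f : Lp ℂ 2 (volume : Measure E)) k‖ ^ 2 := by
  obtain ⟨C, hC, hGN⟩ := lintegral_norm_rpow_le (E := E) hp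
  refine ⟨C, hC, fun f hf => ?_⟩
  set w := (𝓕 f : Lp ℂ 2 (volume : Measure E)) with hw
  have hp0 : 0 < p := by linarith
  have hθ0 : 0 ≤ θ := by
    rw [hθ]
    have : 0 ≤ p - 2 := by linarith
    positivity
  have hnn : ∀ k, 0 ≤ symbol k ^ θ * ‖w k‖ ^ 2 := fun k =>
    mul_nonneg (Real.rpow_nonneg (symbol_pos k).le _) (by positivity)
  have hmain : ∫⁻ x, ENNReal.ofReal (‖f x‖ ^ p) ≤ ENNReal.ofReal (C * ‖f‖ ^ (p - 2) *
        ∫ k, symbol k ^ θ * ‖w k‖ ^ 2) := by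
    refine (hGN f).trans ?_
    rw [ENNReal.ofReal_mul (q := ∫ k, _) (by positivity), ofReal_integral_eq_lintegral_ofReal hf
      (Filter.Eventually.of_forall hnn)]
    refine mul_le_mul_right (lintegral_mono fun k => ?_) _
    rw [ENNReal.ofReal_mul (Real.rpow_nonneg (symbol_pos k).le _), ENNReal.ofReal_pow
      (norm_nonneg _), ofReal_norm]
    refine mul_le_mul_left (ENNReal.ofReal_le_ofReal ?_) _
    calc ‖k‖ ^ (Module.finrank ℝ E * (p - 2) / 2) = (‖k‖ ^ 2) ^ θ := by
          rw [← Real.rpow_two, ← Real.rpow_mul (norm_nonneg _), hθ]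
          congr 1
          ring
      _ ≤ symbol k ^ θ := by
          refine Real.rpow_le_rpow (by positivity) ?_ hθ0
          linarith [one_add_norm_sq_le_symbol k]
  have hmeas : AEStronglyMeasurable (fun x => ‖f x‖ ^ p) volume :=
    ((Lp.aestronglyMeasurable f).norm.aemeasurable.pow_const p).aestronglyMeasurable
  constructor
  · refine ⟨Lp.aestronglyMeasurable f, ?_⟩
    rw [eLpNorm_lt_top_iff_lintegral_rpow_enorm_lt_top (by simpa using hp0) ENNReal.ofReal_ne_top,
      ENNReal.toReal_ofReal hp0.le]
    refine lt_of_eq_of_lt ?_ (hmain.trans_lt ENNReal.ofReal_lt_top)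
    congr 1
    ext x
    rw [← ofReal_norm, ENNReal.ofReal_rpow_of_nonneg (norm_nonneg _) hp0.le]
  · rw [integral_eq_lintegral_of_nonneg_ae (Filter.Eventually.of_forall
      fun x => Real.rpow_nonneg (norm_nonneg _) _) hmeas]
    exact ENNReal.toReal_le_of_le_ofReal (mul_nonneg (by positivity) (integral_nonneg hnn)) hmain

theorem norm_sq_weakDeriv_line (u : Lp ℂ 2 (volume : Measure ℝ)) (hu : MemH1 u) :
    Integrable (fun k => symbol k * ‖(𝓕 u : Lp ℂ 2 (volume : Measure ℝ)) k‖ ^ 2) ∧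
      ‖weakDeriv u hu 1‖ ^ 2 + ‖u‖ ^ 2
        = ∫ k, symbol k * ‖(𝓕 u : Lp ℂ 2 (volume : Measure ℝ)) k‖ ^ 2 := by
  obtain ⟨h1, h2⟩ := norm_sq_weakDeriv u hu 1
  have h3 : ∀ k : ℝ, symbol k * ‖(𝓕 u : Lp ℂ 2 (volume : Measure ℝ)) k‖ ^ 2
      = (2 * Real.pi * inner ℝ k 1) ^ 2 * ‖(𝓕 u : Lp ℂ 2 (volume : Measure ℝ)) k‖ ^ 2
        + ‖(𝓕 u : Lp ℂ 2 (volume : Measure ℝ)) k‖ ^ 2 := by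
    intro k
    simp only [symbol, Real.norm_eq_abs, mul_pow, sq_abs, RCLike.inner_apply, conj_trivial, one_mul]
    ring
  simp_rw [h3]
  refine ⟨h1.add (integrable_norm_sq _), ?_⟩
  rw [integral_add h1 (integrable_norm_sq _), h2, integral_norm_fourier_sq]

theorem gradNormSq_add_norm_sq (φ : Lp ℂ 2 (volume : Measure Plane)) (hφ : MemH1 φ) :
    Integrable (fun k => symbol k * ‖(𝓕 φ : Lp ℂ 2 (volume : Measure Plane)) k‖ ^ 2) ∧
      gradNormSq φ hφ + ‖φ‖ ^ 2
        = ∫ k, symbol k * ‖(𝓕 φ : Lp ℂ 2 (volume : Measure Plane)) k‖ ^ 2 := by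
  have h := fun i : Fin 2 => norm_sq_weakDeriv φ hφ (EuclideanSpace.single i 1)
  have h3 : ∀ k : Plane, symbol k * ‖(𝓕 φ : Lp ℂ 2 (volume : Measure Plane)) k‖ ^ 2
      = (∑ i : Fin 2, (2 * Real.pi * inner ℝ k (EuclideanSpace.single i 1)) ^ 2
          * ‖(𝓕 φ : Lp ℂ 2 (volume : Measure Plane)) k‖ ^ 2)
        + ‖(𝓕 φ : Lp ℂ 2 (volume : Measure Plane)) k‖ ^ 2 := by
    intro k
    rw [symbol, mul_pow, EuclideanSpace.norm_sq_eq]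
    simp only [Fin.sum_univ_two, EuclideanSpace.inner_single_right, Real.norm_eq_abs, sq_abs,
      conj_trivial]
    ring
  simp_rw [h3]
  have hs := integrable_finsetSum Finset.univ fun i _ => (h i).1
  refine ⟨hs.add (integrable_norm_sq _), ?_⟩
  rw [integral_add hs (integrable_norm_sq _), integral_norm_fourier_sq,
    integral_finsetSum _ fun i _ => (h i).1, gradNormSq]
  simp_rw [(h _).2]

/-- Inversion bounds the value by ∫|û|, and Cauchy–Schwarz inserts J^(-3/8) J^(3/8). Any exponent
strictly between 1/2 and 1 could replace 3/4: above 1/2 for integrability of the negative power on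
the line, below 1 for absorption by the kinetic energy. -/
theorem exists_norm_pointValue_sq_le :
    ∃ C : ℝ, 0 ≤ C ∧ ∀ (u : Lp ℂ 2 (volume : Measure ℝ)) (hu : MemH1 u) (x : ℝ),
      ‖pointValue u hu x‖ ^ 2
        ≤ C * ∫ k, symbol k ^ (3 / 4 : ℝ) * ‖(𝓕 u : Lp ℂ 2 (volume : Measure ℝ)) k‖ ^ 2 := by
  have hnn : ∀ (s : ℝ) (k : ℝ), 0 ≤ symbol k ^ s := fun s k => Real.rpow_nonneg (symbol_pos k).le _
  refine ⟨∫ k : ℝ, symbol k ^ (-(3 / 4) : ℝ), integral_nonneg (hnn _), fun u hu x => ?_⟩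
  set w := (𝓕 u : Lp ℂ 2 (volume : Measure ℝ)) with hw
  have h34 := integrable_symbol_rpow_mul (norm_sq_weakDeriv_line u hu).1
    (θ := 3 / 4) (by norm_num)
  have hneg : Integrable fun k : ℝ => symbol k ^ (-(3 / 4) : ℝ) :=
    integrable_symbol_rpow_neg (by rw [Module.finrank_self]; norm_num)
  set f : ℝ → ℝ := fun k => symbol k ^ (-(3 / 8) : ℝ) with hf
  set g : ℝ → ℝ := fun k => symbol k ^ (3 / 8 : ℝ) * ‖w k‖ with hg
  have hf2 : ∀ k, f k ^ 2 = symbol k ^ (-(3 / 4) : ℝ) := by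
    intro k
    rw [hf, ← Real.rpow_two, ← Real.rpow_mul (symbol_pos k).le]
    norm_num
  have hg2 : ∀ k, g k ^ 2 = symbol k ^ (3 / 4 : ℝ) * ‖w k‖ ^ 2 := by
    intro k
    rw [hg, mul_pow, ← Real.rpow_two, ← Real.rpow_mul (symbol_pos k).le]
    norm_num
  have hfg : ∀ k, f k * g k = ‖w k‖ := by
    intro k
    rw [hf, hg, ← mul_assoc, ← Real.rpow_add (symbol_pos k)]
    norm_num
  have hfm : MemLp f 2 := by
    rw [memLp_two_iff_integrable_sq (measurable_symbol.pow_const _).aestronglyMeasurable]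
    exact hneg.congr (Filter.Eventually.of_forall fun k => (hf2 k).symm)
  have hgm : MemLp g 2 := by
    have hm : AEStronglyMeasurable g volume :=
      (measurable_symbol.pow_const _).aestronglyMeasurable.mul (Lp.aestronglyMeasurable w).norm
    rw [memLp_two_iff_integrable_sq hm]
    exact h34.congr (Filter.Eventually.of_forall fun k => (hg2 k).symm)
  have hwi : Integrable w := by
    rw [← integrable_norm_iff (Lp.aestronglyMeasurable w)]
    exact (hfm.integrable_mul hgm).congr (Filter.Eventually.of_forall hfg)
  have hle : ∫ k, ‖w k‖ ≤ (∫ k, f k ^ (2 : ℝ)) ^ (1 / 2 : ℝ) * (∫ k, g k ^ (2 : ℝ)) ^ (1 / 2 : ℝ) := by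
    simp_rw [← hfg]
    refine integral_mul_le_Lp_mul_Lq_of_nonneg Real.HolderConjugate.two_two
      (Filter.Eventually.of_forall fun k => hnn _ k)
      (Filter.Eventually.of_forall fun k => mul_nonneg (hnn _ k) (norm_nonneg _)) ?_ ?_
    · simpa using hfm
    · simpa using hgm
  simp_rw [Real.rpow_two, hf2, hg2, ← Real.sqrt_eq_rpow] at hle
  rw [pointValue_eq u hu _ (continuous_fourierInv_of_integrable hwi) (ae_eq_fourierInv u hwi)]
  have hx : ‖𝓕⁻ (w : ℝ → ℂ) x‖ ≤ ∫ k, ‖w k‖ :=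
    VectorFourier.norm_fourierIntegral_le_integral_norm _ _ _ _ _
  calc ‖𝓕⁻ (w : ℝ → ℂ) x‖ ^ 2 ≤ (√(∫ k : ℝ, symbol k ^ (-(3 / 4) : ℝ)) *
        √(∫ k, symbol k ^ (3 / 4 : ℝ) * ‖w k‖ ^ 2)) ^ 2 := by
        gcongr
        exact hx.trans hle
    _ = _ := by
        rw [mul_pow, Real.sq_sqrt (integral_nonneg (hnn _)), Real.sq_sqrt (integral_nonneg fun k =>
          mul_nonneg (hnn _ k) (by positivity))]

theorem line_memLp {p : ℝ} (hp : 2 < p) (hp' : p < 6) (u : Lp ℂ 2 (volume : Measure ℝ))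
    (hu : MemH1 u) : MemLp u (ENNReal.ofReal p) := by
  obtain ⟨C, -, h⟩ := memLp_and_integral_rpow_le (E := ℝ) hp rfl
  refine (h u (integrable_symbol_rpow_mul (norm_sq_weakDeriv_line u hu).1 ?_)).1
  rw [Module.finrank_self]
  push_cast
  linarith

theorem exists_line_lower_bound {p : ℝ} (hp : 2 < p) (hp' : p < 6) {κ : ℝ} (hκ : 0 ≤ κ) (μ : ℝ) :
    ∃ M : ℝ, ∀ (u : Lp ℂ 2 (volume : Measure ℝ)) (hu : MemH1 u), ‖u‖ ^ 2 ≤ μ →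
      -M ≤ 1 / 2 * ‖weakDeriv u hu 1‖ ^ 2 - 1 / p * (∫ x, ‖u x‖ ^ p)
        - κ * ‖pointValue u hu 0‖ ^ 2 := by
  set θ : ℝ := Module.finrank ℝ ℝ * (p - 2) / 4 with hθ
  have hθ0 : 0 ≤ θ := by
    rw [hθ, Module.finrank_self]; push_cast; linarith
  have hθ1 : θ < 1 := by
    rw [hθ, Module.finrank_self]; push_cast; linarith
  obtain ⟨C₁, hC₁, h₁⟩ := memLp_and_integral_rpow_le (E := ℝ) hp hθ
  obtain ⟨C₂, hC₂, h₂⟩ := exists_norm_pointValue_sq_le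
  set A := 1 / p * (C₁ * √μ ^ (p - 2)) with hA
  have hA0 : 0 ≤ A := by positivity
  obtain ⟨M₁, hM₁, hy₁⟩ := exists_mul_rpow_le hθ1 hθ0 hA0 (ε := 1 / 4) (by norm_num)
  obtain ⟨M₂, hM₂, hy₂⟩ := exists_mul_rpow_le (θ := 3 / 4) (by norm_num) (by norm_num)
    (mul_nonneg hκ hC₂) (ε := 1 / 4) (by norm_num)
  -- The two shares ε = 1/4 use up ½∫ J|û|², which exceeds the kinetic term by ½‖u‖²; hence the 1/2
  -- here.
  refine ⟨(1 / 2 + M₁ + M₂) * μ, fun u hu hμ => ?_⟩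
  set w := (𝓕 u : Lp ℂ 2 (volume : Measure ℝ)) with hw
  obtain ⟨hi, hgrad⟩ := norm_sq_weakDeriv_line u hu
  have hiθ := integrable_symbol_rpow_mul hi hθ1.le
  have hi34 := integrable_symbol_rpow_mul hi (θ := 3 / 4) (by norm_num)
  have hi2 := integrable_norm_sq w
  have hnorm : ‖u‖ ≤ √μ := Real.le_sqrt_of_sq_le hμ
  have e1 : 1 / p * (∫ x, ‖u x‖ ^ p) ≤ A * ∫ k, symbol k ^ θ * ‖w k‖ ^ 2 := by
    rw [hA, mul_assoc (1 / p)]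
    refine mul_le_mul_of_nonneg_left ((h₁ u hiθ).2.trans ?_) (by positivity)
    refine mul_le_mul_of_nonneg_right ?_ (integral_nonneg fun k =>
      mul_nonneg (Real.rpow_nonneg (symbol_pos k).le _) (by positivity))
    exact mul_le_mul_of_nonneg_left (Real.rpow_le_rpow (norm_nonneg _) hnorm (by linarith)) hC₁
  have e2 : κ * ‖pointValue u hu 0‖ ^ 2
      ≤ κ * C₂ * ∫ k, symbol k ^ (3 / 4 : ℝ) * ‖w k‖ ^ 2 := by
    rw [mul_assoc]
    exact mul_le_mul_of_nonneg_left (h₂ u hu 0) hκ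
  have e3 : A * (∫ k, symbol k ^ θ * ‖w k‖ ^ 2)
        + κ * C₂ * (∫ k, symbol k ^ (3 / 4 : ℝ) * ‖w k‖ ^ 2)
      ≤ 1 / 2 * (∫ k, symbol k * ‖w k‖ ^ 2) + (M₁ + M₂) * ∫ k, ‖w k‖ ^ 2 := by
    simp_rw [← integral_const_mul]
    rw [← integral_add (hiθ.const_mul _) (hi34.const_mul _),
      ← integral_add (hi.const_mul _) (hi2.const_mul _)]
    refine integral_mono ((hiθ.const_mul _).add (hi34.const_mul _))
      ((hi.const_mul _).add (hi2.const_mul _)) fun k => ?_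
    have a1 := hy₁ (symbol k) (symbol_pos k)
    have a2 := hy₂ (symbol k) (symbol_pos k)
    have a3 := sq_nonneg ‖w k‖
    simp only
    nlinarith
  rw [hw, integral_norm_fourier_sq, ← hw, ← hgrad] at e3
  nlinarith

/-- The singular part contributes |q|² J^(θ-2), integrable in two dimensions when θ < 1; thus v has
fractional regularity although it need not be in H¹. -/
theorem integrable_symbol_rpow_mul_of_decomp {v φ : Lp ℂ 2 (volume : Measure Plane)}
    (hφ : MemH1 φ) {q : ℂ} (h : ∀ᵐ x : Plane, v x = φ x + q * green x) {θ : ℝ} (hθ : θ < 1) :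
    Integrable fun k => symbol k ^ θ * ‖(𝓕 v : Lp ℂ 2 (volume : Measure Plane)) k‖ ^ 2 := by
  have h1 := integrable_symbol_rpow_mul (gradNormSq_add_norm_sq φ hφ).1 hθ.le
  have h2 : Integrable fun k : Plane => symbol k ^ (-(2 - θ)) :=
    integrable_symbol_rpow_neg (by rw [finrank_euclideanSpace, Fintype.card_fin]; push_cast; linarith)
  refine ((h1.const_mul 2).add (h2.const_mul (2 * ‖q‖ ^ 2))).mono' ?_ ?_
  · exact (measurable_symbol.pow_const θ).aestronglyMeasurable.mul
      ((Lp.aestronglyMeasurable _).norm.pow 2)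
  · filter_upwards [fourier_of_decomp h] with k hk
    have hs := symbol_pos k
    have hsθ : 0 < symbol k ^ θ := Real.rpow_pos_of_pos hs _
    have e3 : symbol k ^ (-(2 - θ)) = symbol k ^ θ * (symbol k)⁻¹ ^ 2 := by
      rw [neg_sub, Real.rpow_sub hs, Real.rpow_two, div_eq_mul_inv, inv_pow]
    rw [Real.norm_of_nonneg (by positivity), hk]
    change _ ≤ 2 * (symbol k ^ θ * _) + 2 * ‖q‖ ^ 2 * symbol k ^ (-(2 - θ))
    rw [e3]
    set z := (𝓕 φ : Lp ℂ 2 (volume : Measure Plane)) k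
    have e4 : ‖z + q * ((1 + (2 * Real.pi * ‖k‖) ^ 2)⁻¹ : ℝ)‖ ≤ ‖z‖ + ‖q‖ * (symbol k)⁻¹ := by
      refine (norm_add_le _ _).trans_eq ?_
      rw [norm_mul, Complex.norm_real, Real.norm_of_nonneg (by positivity), symbol]
    calc symbol k ^ θ * ‖z + q * ((1 + (2 * Real.pi * ‖k‖) ^ 2)⁻¹ : ℝ)‖ ^ 2
        ≤ symbol k ^ θ * (2 * (‖z‖ ^ 2 + (‖q‖ * (symbol k)⁻¹) ^ 2)) := by
          gcongr
          exact (pow_le_pow_left₀ (norm_nonneg _) e4 2).trans add_sq_le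
      _ = _ := by ring

theorem plane_memLp {r : ℝ} (hr : 2 < r) (hr' : r < 4) {v φ : Lp ℂ 2 (volume : Measure Plane)}
    (hφ : MemH1 φ) {q : ℂ} (h : ∀ᵐ x : Plane, v x = φ x + q * green x) :
    MemLp v (ENNReal.ofReal r) := by
  obtain ⟨C, -, hC⟩ := memLp_and_integral_rpow_le (E := Plane) hr rfl
  refine (hC v (integrable_symbol_rpow_mul_of_decomp hφ h ?_)).1
  rw [finrank_euclideanSpace, Fintype.card_fin]
  push_cast
  linarith

/-- With y = z + q/J, the right side minus the left is the perfect square a|y - q/a|². -/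
theorem norm_sq_mul_inv_sub_le {J a : ℝ} (hJ : 0 < J) (ha : 0 < a) (z q : ℂ) :
    ‖q‖ ^ 2 * (J⁻¹ - a⁻¹)
      ≤ J * ‖z‖ ^ 2 + (a - J) * ‖z + q * ((J⁻¹ : ℝ) : ℂ)‖ ^ 2 := by
  set y := z + q * ((J⁻¹ : ℝ) : ℂ) with hy
  have hz : z = y - ((J⁻¹ : ℝ) : ℂ) * q := by rw [hy]; ring
  have e1 : J * ‖z‖ ^ 2 = J * ‖y‖ ^ 2 - 2 * (y * starRingEnd ℂ q).re + J⁻¹ * ‖q‖ ^ 2 := by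
    rw [hz]
    simp only [Complex.sq_norm, Complex.normSq_apply, Complex.sub_re, Complex.sub_im,
      Complex.mul_re, Complex.mul_im, Complex.ofReal_re, Complex.ofReal_im, Complex.conj_re,
      Complex.conj_im]
    field_simp
    ring
  have e2 : 0 ≤ a * ‖y - ((a⁻¹ : ℝ) : ℂ) * q‖ ^ 2 := by positivity
  have e3 : a * ‖y - ((a⁻¹ : ℝ) : ℂ) * q‖ ^ 2
      = a * ‖y‖ ^ 2 - 2 * (y * starRingEnd ℂ q).re + a⁻¹ * ‖q‖ ^ 2 := by
    simp only [Complex.sq_norm, Complex.normSq_apply, Complex.sub_re, Complex.sub_im,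
      Complex.mul_re, Complex.mul_im, Complex.ofReal_re, Complex.ofReal_im, Complex.conj_re,
      Complex.conj_im]
    field_simp
    ring
  linarith

theorem exists_plane_lower_bound {r : ℝ} (hr : 2 < r) (hr' : r < 4) (B μ : ℝ) :
    ∃ M : ℝ, ∀ (v φ : Lp ℂ 2 (volume : Measure Plane)) (hφ : MemH1 φ) (q : ℂ),
      (∀ᵐ x : Plane, v x = φ x + q * green x) → ‖v‖ ^ 2 ≤ μ →
      B * ‖q‖ ^ 2 - M ≤ 1 / 2 * (gradNormSq φ hφ + ‖φ‖ ^ 2) - 1 / 2 * ‖v‖ ^ 2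
        - 1 / r * (∫ x, ‖v x‖ ^ r) := by
  set θ : ℝ := Module.finrank ℝ Plane * (r - 2) / 4 with hθ
  have hθ0 : 0 ≤ θ := by
    rw [hθ, finrank_euclideanSpace, Fintype.card_fin]; push_cast; linarith
  have hθ1 : θ < 1 := by
    rw [hθ, finrank_euclideanSpace, Fintype.card_fin]; push_cast; linarith
  obtain ⟨C₁, hC₁, h₁⟩ := memLp_and_integral_rpow_le (E := Plane) hr hθ
  set A := 1 / r * (C₁ * √μ ^ (r - 2)) with hA
  have hA0 : 0 ≤ A := by positivity
  -- The constants 2A and 2B compensate for the factor 1/2 in front of the quadratic part of the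
  -- energy.
  obtain ⟨M, hM, hDi, hDB⟩ := exists_le_integral_inv_symbol_sub hθ0 hθ1
    (mul_nonneg zero_le_two hA0) (2 * B)
  refine ⟨|M| / 2 * μ, fun v φ hφ q h hμ => ?_⟩
  set w := (𝓕 v : Lp ℂ 2 (volume : Measure Plane)) with hw
  obtain ⟨hi, hgrad⟩ := gradNormSq_add_norm_sq φ hφ
  have hiθ := integrable_symbol_rpow_mul_of_decomp hφ h hθ1
  have hi2 := integrable_norm_sq w
  have hnorm : ‖v‖ ≤ √μ := Real.le_sqrt_of_sq_le hμ
  have e1 : 1 / r * (∫ x, ‖v x‖ ^ r) ≤ A * ∫ k, symbol k ^ θ * ‖w k‖ ^ 2 := by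
    rw [hA, mul_assoc (1 / r)]
    refine mul_le_mul_of_nonneg_left ((h₁ v hiθ).2.trans ?_) (by positivity)
    refine mul_le_mul_of_nonneg_right ?_ (integral_nonneg fun k =>
      mul_nonneg (Real.rpow_nonneg (symbol_pos k).le _) (by positivity))
    exact mul_le_mul_of_nonneg_left (Real.rpow_le_rpow (norm_nonneg _) hnorm (by linarith)) hC₁
  have e2 : ‖q‖ ^ 2 * (2 * B) ≤ (∫ k, symbol k * ‖(𝓕 φ : Lp ℂ 2 (volume : Measure Plane)) k‖ ^ 2)
      + ((M - 1) * (∫ k, ‖w k‖ ^ 2) - 2 * A * ∫ k, symbol k ^ θ * ‖w k‖ ^ 2) := by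
    refine (mul_le_mul_of_nonneg_left hDB (sq_nonneg _)).trans ?_
    simp_rw [← integral_const_mul]
    have hsub : Integrable fun k =>
        (M - 1) * ‖w k‖ ^ 2 - 2 * A * (symbol k ^ θ * ‖w k‖ ^ 2) :=
      (hi2.const_mul _).sub (hiθ.const_mul _)
    rw [← integral_sub (hi2.const_mul _) (hiθ.const_mul _), ← integral_add hi hsub]
    refine integral_mono_ae (hDi.const_mul _) (hi.add hsub) ?_
    filter_upwards [fourier_of_decomp h] with k hk
    have hs := symbol_pos k
    have := norm_sq_mul_inv_sub_le hs ((half_pos hs).trans_le (hM k))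
      ((𝓕 φ : Lp ℂ 2 (volume : Measure Plane)) k) q
    rw [symbol, ← hk, ← symbol, ← hw] at this
    refine this.trans_eq ?_
    ring
  rw [hw, integral_norm_fourier_sq, ← hw, ← hgrad] at e2
  have e3 : M * ‖v‖ ^ 2 ≤ |M| * μ := by
    calc M * ‖v‖ ^ 2 ≤ |M| * ‖v‖ ^ 2 := by gcongr; exact le_abs_self M
      _ ≤ |M| * μ := by gcongr
  linarith

end Energy

end Hybrid

end

theorem proposition3p3 (p r α σ β : ℝ) (hp : 2 < p) (hp' : p < 6) (hr : 2 < r) (hr' : r < 4)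
    (hβ : 0 ≤ β) :
    (∀ U : Hybrid.EnergyDomain, MemLp U.u (ENNReal.ofReal p) ∧ MemLp U.v (ENNReal.ofReal r)) ∧
      ∀ μ : ℝ, 0 < μ →
        BddBelow (Hybrid.energy p r α σ β '' {U : Hybrid.EnergyDomain | U.mass = μ}) := by
  refine ⟨fun U => ⟨Hybrid.line_memLp hp hp' U.u U.u_mem,
    Hybrid.plane_memLp hr hr' U.φ_mem U.decomp⟩, fun μ _ => ?_⟩
  -- The coefficients cover the worst signs of α and σ, plus the two halves of β|q||u(0)| ≤ ½|q|² +
  -- ½β²|u(0)|².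
  obtain ⟨M₁, h₁⟩ := Hybrid.exists_line_lower_bound hp hp' (κ := |α| / 2 + β ^ 2 / 2)
    (by positivity) μ
  obtain ⟨M₂, h₂⟩ := Hybrid.exists_plane_lower_bound hr hr' (|σ| / 2 + 1 / 2) μ
  refine ⟨-M₁ - M₂, ?_⟩
  rintro _ ⟨U, hU, rfl⟩
  have hmass : ‖U.u‖ ^ 2 + ‖U.v‖ ^ 2 = μ := by
    rw [Hybrid.norm_sq_eq_integral, Hybrid.norm_sq_eq_integral]
    exact hU
  have e1 := h₁ U.u U.u_mem (by nlinarith [sq_nonneg ‖U.v‖])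
  have e2 := h₂ U.v U.φ U.φ_mem U.q U.decomp (by nlinarith [sq_nonneg ‖U.u‖])
  simp only [Hybrid.energy, Hybrid.lineEnergy, Hybrid.planeEnergy, Hybrid.junctionEnergy]
  set y := Hybrid.pointValue U.u U.u_mem 0
  have e3 : β * (starRingEnd ℂ U.q * y).re ≤ 1 / 2 * ‖U.q‖ ^ 2 + β ^ 2 / 2 * ‖y‖ ^ 2 := by
    have h3 : (starRingEnd ℂ U.q * y).re ≤ ‖U.q‖ * ‖y‖ := by
      refine (Complex.re_le_norm _).trans_eq ?_
      rw [norm_mul, RCLike.norm_conj]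
    nlinarith [mul_le_mul_of_nonneg_left h3 hβ, sq_nonneg (‖U.q‖ - β * ‖y‖)]
  have e4 : -|α| * ‖y‖ ^ 2 ≤ α * ‖y‖ ^ 2 :=
    mul_le_mul_of_nonneg_right (neg_abs_le α) (sq_nonneg _)
  have e5 : -|σ| * ‖U.q‖ ^ 2 ≤ σ * ‖U.q‖ ^ 2 :=
    mul_le_mul_of_nonneg_right (neg_abs_le σ) (sq_nonneg _)
  linarith
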